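/- Let $N>0$ and $0\le n_0<n_1<\dots<n_{N-1}<M$ be natural numbers, let $0<\rho<\infty$, and let $c_{n_0},\dots,c_{n_{N-1}}$ be positive reals. Let $\mathbb{P}_N((0,\rho))$ denote the set of positive semidefinite real symmetric $N\times N$ matrices all of whose entries lie in $(0,\rho)$. A function $f$ is said to entrywise preserve positivity on $\mathbb{P}_N((0,\rho))$ if $f[A]:=(f(a_{jk}))_{j,k}$ is positive semidefinite for every $A=(a_{jk})\in\mathbb{P}_N((0,\rho))$. Write $A^{\circ m}:=(a_{jk}^m)_{j,k}$ for the entrywise power, and $A\preceq B$ if $B-A$ is positive semidefinite. (a) There exists a negative number $c_M$ such that the polynomial $$x\mapsto c_{n_0}x^{n_0}+c_{n_1}x^{n_1}+\dots+c_{n_{N-1}}x^{n_{N-1}}+c_Mx^M$$ entrywise preserves positivity on $\mathbb{P}_N((0,\rho))$. (b) This is equivalent to a matrix inequality: for every real $t>0$, the polynomial $\sum_{j=0}^{N-1}c_{n_j}x^{n_j}-t^{-1}x^M$ entrywise preserves positivity on $\mathbb{P}_N((0,\rho))$ if and only if $A^{\circ M}\preceq t\sum_{j=0}^{N-1}c_{n_j}A^{\circ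 n_j}$ for all $A\in\mathbb{P}_N((0,\rho))$. (c) The following explicit threshold works: let $$\mathcal{K}:=\sum_{j=0}^{N-1}\frac{V(\mathbf{n}_j)^2}{V(\mathbf{n}_{\min})^2}\,\frac{\rho^{M-n_j}}{c_{n_j}},$$ where $V(t_0,\dots,t_{N-1}):=\prod_{0\le a<b\le N-1}(t_b-t_a)$ is the Vandermonde determinant, $\mathbf{n}_j:=(n_0,\dots,n_{j-1},n_{j+1},\dots,n_{N-1},M)$ and $\mathbf{n}_{\min}:=(0,1,\dots,N-1)$. Then $\mathcal{K}>0$, and $$A^{\circ M}\preceq\mathcal{K}\sum_{j=0}^{N-1}c_{n_j}A^{\circ n_j}\qquad\text{for all }A\in\mathbb{P}_N((0,\rho)).$$ -/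

import Mathlib

open scoped MatrixOrder

/-- `psdMatrices N I` is the set `P_N(I)` of positive semidefinite real symmetric `N × N` matrices
all of whose entries lie in `I ⊆ ℝ`. -/
def psdMatrices (N : ℕ) (I : Set ℝ) : Set (Matrix (Fin N) (Fin N) ℝ) :=
  {A | A.PosSemidef ∧ ∀ j k, A j k ∈ I}

/-- The function `f` entrywise preserves positivity on the set `S` of `N × N` matrices:
`f[A] = (f (a j k))` is positive semidefinite for every `A ∈ S`. -/
def EntrywisePreservesPositivity {N : ℕ} (f : ℝ → ℝ) (S : Set (Matrix (Fin N) (Fin N) ℝ)) : Prop :=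
  ∀ A ∈ S, (A.map f).PosSemidef

/-- The entrywise (Hadamard) power `A^{∘m}`. -/
def hadamardPow {N : ℕ} (A : Matrix (Fin N) (Fin N) ℝ) (m : ℕ) : Matrix (Fin N) (Fin N) ℝ :=
  A.map (fun x => x ^ m)

/-- The Vandermonde determinant `V(t) = det (t_i ^ j) = ∏_{i < j} (t_j - t_i)` of a tuple of natural
numbers, as a real number. -/
noncomputable def vandermondeDet {N : ℕ} (t : Fin N → ℕ) : ℝ :=
  (Matrix.vandermonde (fun i => (t i : ℝ))).det

/-- The minimal tuple `(0, 1, …, N-1)`. -/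
def minTuple (N : ℕ) : Fin N → ℕ := fun i => (i : ℕ)

/-- The tuple `(n_0, …, n_{j-1}, n_{j+1}, …, n_{N-1}, M)`: append `M` to `n`, then drop the entry
with index `j`. -/
def replaceTuple {N : ℕ} (n : Fin N → ℕ) (M : ℕ) (j : Fin N) : Fin N → ℕ :=
  fun i => (Fin.snoc n M : Fin (N + 1) → ℕ) (j.castSucc.succAbove i)

/-- The explicit threshold `∑_j (V(n_j)² / V(n_min)²) * (ρ^{M - n_j} / c_{n_j})`. The natural-number
subtraction `M - n j` is the true one, since `n j < M` wherever this is used. -/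
noncomputable def threshold {N : ℕ} (n : Fin N → ℕ) (M : ℕ) (c : Fin N → ℝ) (ρ : ℝ) : ℝ :=
  ∑ j, vandermondeDet (replaceTuple n M j) ^ 2 / vandermondeDet (minTuple N) ^ 2 *
    (ρ ^ (M - n j) / c j)

/-!
The heart of the matter is the explicit threshold `K`: the negative coefficient is then `-K⁻¹`, and
the reformulation as a Loewner inequality is a rescaling by `t`. The inequality
`A^{∘M} ≤ K ∑ c_j A^{∘n_j}` says that `f x = K ∑ c_j x ^ n_j - x ^ M` preserves positivity
(`threshold_preservesPositivity`); it is proved by induction on the dimension `N`.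

*Rank one.* For `A = u uᵀ` with distinct nodes `u_i`, Cramer's rule (`genVandermondeDet_mul_pow`)
writes the vector `u ^ M` as a combination of the vectors `u ^ n_j`, with coefficients
`± D(n_j) / D(n)`, where `D(m) = det (u_i ^ m_k)` and the bold tuple `n_j` is `replaceTuple n M j`.
By Cauchy-Schwarz the inequality follows once
`|D(n_j) / D(n)| ≤ V(n_j) / V(n_min) * √ρ ^ (M - n_j)`. This comes from the two-sided estimate
`V(u) u^n ≤ D(n) u^{n_min} ≤ V(n) / V(n_min) * V(u) u^n` for increasing positive nodes
(`genVandermondeDet_bounds`), whose lower and upper parts are applied to `D(n)` and `D(n_j)`. In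
terms of Schur polynomials, it bounds `s_λ(u)` below by its leading monomial and above by that
monomial times the number of tableaux. It is proved by induction from the branching rule
`genVandermondeDet_succ`, the quotient `V(n) / V(n_min) = det (n_i.choose j)` obeying the same
rule (`chooseDet_succ`). Repeated nodes are reached by a limit.

*Higher rank.* If `f` is positivity preserving on rank-one matrices and `f'` is so in dimension
`N - 1`, then `f` preserves positivity in dimension `N` (`entrywisePreservesPositivity_succ`): `A`
is joined by a segment to the rank-one matrix sharing its first row and column. Here `f'` is again
of the required form, up to its lowest term, which is harmless by the Schur product theorem, and
the induction closes because `M` times the threshold of the remaining terms is at most `K`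
(`mul_threshold_derivative_le`).
-/

/-! ### Generalized Vandermonde determinants -/

/-- The generalized Vandermonde determinant `det (u_i ^ n_j)`. -/
noncomputable def genVandermondeDet {R : Type*} [CommRing R] {N : ℕ} (u : Fin N → R)
    (n : Fin N → ℕ) : R :=
  (Matrix.of fun i j => u i ^ n j).det

/-- The determinant of binomial coefficients `det ((n_i).choose j)`. It equals the quotient
`V(n) / V(0, 1, …, N-1)` of Vandermonde determinants. -/
noncomputable def chooseDet {N : ℕ} (n : Fin N → ℕ) : ℝ :=
  (Matrix.of fun i j : Fin N => ((n i).choose j : ℝ)).det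

/-- The tuples `m` of length `N` interlacing `n`, that is, `n i ≤ m i < n (i + 1)`. -/
def interlacing {N : ℕ} (n : Fin (N + 1) → ℕ) : Finset (Fin N → ℕ) :=
  Fintype.piFinset fun i => Finset.Ico (n i.castSucc) (n i.succ)

theorem det_sum_rows {R : Type*} [CommRing R] {N : ℕ} {α : Type*} (S : Fin N → Finset α)
    (g : Fin N → α → Fin N → R) :
    (Matrix.of fun i j => ∑ a ∈ S i, g i a j).det =
      ∑ r ∈ Fintype.piFinset S, (Matrix.of fun i j => g i (r i) j).det := by
  have := (Matrix.detRowAlternating (n := Fin N) (R := R)).toMultilinearMap.map_sum_finset g S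
  refine Eq.trans ?_ this
  refine congrArg Matrix.det (Matrix.ext fun i j => ?_)
  simp [Finset.sum_apply]

theorem det_sum_columns {R : Type*} [CommRing R] {N : ℕ} {α : Type*} (S : Fin N → Finset α)
    (g : Fin N → α → Fin N → R) :
    (Matrix.of fun i j => ∑ a ∈ S j, g j a i).det =
      ∑ r ∈ Fintype.piFinset S, (Matrix.of fun i j => g j (r j) i).det := by
  rw [← Matrix.det_transpose]
  refine (det_sum_rows S g).trans (Finset.sum_congr rfl fun r _ => ?_)
  rw [← Matrix.det_transpose]
  rfl

/-- Branching rule for generalized Vandermonde determinants: clearing the last row by column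
operations leaves a sum over interlacing tuples. It is the determinantal form of the branching rule
for Schur polynomials. -/
theorem genVandermondeDet_succ {R : Type*} [CommRing R] {N : ℕ} (u : Fin (N + 1) → R)
    (n : Fin (N + 1) → ℕ) (hn : Monotone n) :
    genVandermondeDet u n = u (Fin.last N) ^ n 0 *
      (∏ i : Fin N, (u (Fin.last N) - u i.castSucc)) *
      ∑ m ∈ interlacing n, genVandermondeDet (fun i => u i.castSucc) m *
        ∏ j : Fin N, u (Fin.last N) ^ (n j.succ - 1 - m j) := by
  set y := u (Fin.last N) with hy
  have hle : ∀ j : Fin N, n j.castSucc ≤ n j.succ := fun j => hn (Fin.castSucc_lt_succ).le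
  let B : Matrix (Fin (N + 1)) (Fin (N + 1)) R := Matrix.of fun i j =>
    Fin.cases (u i ^ n 0) (fun j => u i ^ n j.succ - y ^ (n j.succ - n j.castSucc) *
      u i ^ n j.castSucc) j
  have hB : genVandermondeDet u n = B.det := by
    refine Matrix.det_eq_of_forall_col_eq_smul_add_pred
      (fun j : Fin N => y ^ (n j.succ - n j.castSucc)) (fun i => by simp [B]) (fun i j => ?_)
    simp [B]
  have hlast : ∀ j : Fin N, B (Fin.last N) j.succ = 0 := by
    intro j
    simp only [B, Matrix.of_apply, Fin.cases_succ, ← hy]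
    rw [← pow_add, Nat.sub_add_cancel (hle j), sub_self]
  have hminor : (B.submatrix (Fin.last N).succAbove (Fin.succAbove 0)) =
      Matrix.of fun i j => (u i.castSucc - y) * ((Matrix.of fun i j : Fin N =>
        ∑ a ∈ Finset.Ico (n j.castSucc) (n j.succ), u i.castSucc ^ a * y ^ (n j.succ - 1 - a)) i j)
      := by
    ext i j
    simp only [B, Matrix.submatrix_apply, Fin.succAbove_last, Fin.succAbove_zero, Matrix.of_apply,
      Fin.cases_succ]
    rw [mul_geom_sum₂_Ico _ _ (hle j)]
    ring
  rw [hB, Matrix.det_succ_row B (Fin.last N), Fin.sum_univ_succ, hminor, Matrix.det_mul_column,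
    det_sum_columns _ (fun j a (i : Fin N) => u i.castSucc ^ a * y ^ (n j.succ - 1 - a))]
  have hsum : ∀ m : Fin N → ℕ,
      (Matrix.of fun i j : Fin N => u i.castSucc ^ m j * y ^ (n j.succ - 1 - m j)).det =
      genVandermondeDet (fun i => u i.castSucc) m * ∏ j, y ^ (n j.succ - 1 - m j) := by
    intro m
    rw [mul_comm, genVandermondeDet, ← Matrix.det_mul_row]
    congr 1
    ext i j
    simp [mul_comm]
  have hsign : ∏ i : Fin N, (u i.castSucc - y) = (-1) ^ N * ∏ i : Fin N, (y - u i.castSucc) := by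
    have : ∀ i : Fin N, u i.castSucc - y = (-1) * (y - u i.castSucc) := fun i => by ring
    simp_rw [this, Finset.prod_mul_distrib]
    simp
  simp only [hlast, hsum, hsign, interlacing]
  have h1 : ((-1 : R) ^ N) * (-1) ^ N = 1 := by rw [← mul_pow]; simp
  simp only [mul_zero, zero_mul, Finset.sum_const_zero, add_zero, Fin.val_last, Fin.val_zero]
  have hB0 : B (Fin.last N) 0 = y ^ n 0 := by simp [B, hy]
  rw [hB0]
  linear_combination (y ^ n 0 * (∏ i : Fin N, (y - u i.castSucc)) *
    ∑ m ∈ Fintype.piFinset fun i => Finset.Ico (n i.castSucc) (n i.succ),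
      genVandermondeDet (fun i => u i.castSucc) m * ∏ j, y ^ (n j.succ - 1 - m j)) * h1

theorem sum_Ico_choose (a b k : ℕ) (hab : a ≤ b) :
    ∑ m ∈ Finset.Ico a b, (m.choose k : ℝ) = b.choose (k + 1) - a.choose (k + 1) := by
  induction b, hab using Nat.le_induction with
  | base => simp
  | succ b hab ih =>
    rw [Finset.sum_Ico_succ_top hab, ih, Nat.choose_succ_succ]
    push_cast
    ring

/-- The branching rule for `chooseDet`, which is the Schur polynomial at `u = (1, …, 1)`: subtract
consecutive rows and apply the hockey-stick identity to the entries. -/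
theorem chooseDet_succ {N : ℕ} (n : Fin (N + 1) → ℕ) (hn : Monotone n) :
    chooseDet n = ∑ m ∈ interlacing n, chooseDet m := by
  have hle : ∀ j : Fin N, n j.castSucc ≤ n j.succ := fun j => hn (Fin.castSucc_lt_succ).le
  let B : Matrix (Fin (N + 1)) (Fin (N + 1)) ℝ := Matrix.of fun i j =>
    Fin.cases ((n 0).choose j : ℝ)
      (fun i => ((n i.succ).choose j : ℝ) - (n i.castSucc).choose j) i
  have hB : chooseDet n = B.det := by
    refine Matrix.det_eq_of_forall_row_eq_smul_add_pred
      (fun _ : Fin N => 1) (fun i => by simp [B]) (fun i j => ?_)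
    simp [B]
  have hcol : ∀ i : Fin N, B i.succ 0 = 0 := by
    intro i
    simp [B]
  have hminor : B.submatrix (Fin.succAbove 0) Fin.succ = Matrix.of fun i j : Fin N =>
      ∑ m ∈ Finset.Ico (n i.castSucc) (n i.succ), (m.choose j : ℝ) := by
    ext i j
    simp [B, sum_Ico_choose _ _ _ (hle i)]
  rw [hB, Matrix.det_succ_column_zero, Fin.sum_univ_succ, hminor,
    det_sum_rows _ (fun _ (m : ℕ) (j : Fin N) => (m.choose j : ℝ))]
  simp only [hcol]
  simp [B, interlacing, chooseDet]

/-- Column `j` of the matrix of binomial coefficients is `1 / j!` times the monic polynomial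
`descPochhammer ℝ j` evaluated at the `n_i`. -/
theorem vandermondeDet_eq_mul_chooseDet {N : ℕ} (n : Fin N → ℕ) :
    vandermondeDet n = (∏ j : Fin N, ((j : ℕ).factorial : ℝ)) * chooseDet n := by
  rw [chooseDet, ← Matrix.det_mul_row, vandermondeDet,
    Matrix.det_eval_matrixOfPolynomials_eq_det_vandermonde _ (fun j => descPochhammer ℝ j)
      (fun j => descPochhammer_natDegree _ _) (fun j => monic_descPochhammer _ _)]
  congr 1
  ext i j
  simp only [Matrix.of_apply, descPochhammer_eval_eq_descFactorial]
  rw [Nat.descFactorial_eq_factorial_mul_choose]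
  push_cast
  rfl

theorem chooseDet_minTuple (N : ℕ) : chooseDet (minTuple N) = 1 := by
  rw [chooseDet, Matrix.det_of_isLowerTriangular]
  · simp [minTuple]
  · intro i j hij
    have : (i : ℕ) < j := hij
    simp [minTuple, Nat.choose_eq_zero_of_lt this]

theorem vandermondeDet_pos {N : ℕ} {n : Fin N → ℕ} (hn : StrictMono n) : 0 < vandermondeDet n := by
  rw [vandermondeDet, Matrix.det_vandermonde]
  refine Finset.prod_pos fun i _ => Finset.prod_pos fun j hj => ?_
  have := hn (Finset.mem_Ioi.1 hj)
  simpa using this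

theorem minTuple_strictMono (N : ℕ) : StrictMono (minTuple N) := fun _ _ h => h

theorem chooseDet_eq_div {N : ℕ} (n : Fin N → ℕ) :
    chooseDet n = vandermondeDet n / vandermondeDet (minTuple N) := by
  rw [eq_div_iff (vandermondeDet_pos (minTuple_strictMono N)).ne',
    vandermondeDet_eq_mul_chooseDet n, vandermondeDet_eq_mul_chooseDet (minTuple N),
    chooseDet_minTuple]
  ring

theorem chooseDet_pos {N : ℕ} {n : Fin N → ℕ} (hn : StrictMono n) : 0 < chooseDet n := by
  rw [chooseDet_eq_div]
  exact div_pos (vandermondeDet_pos hn) (vandermondeDet_pos (minTuple_strictMono N))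

theorem genVandermondeDet_minTuple {N : ℕ} (u : Fin N → ℝ) :
    genVandermondeDet u (minTuple N) = (Matrix.vandermonde u).det := rfl

/-- The branching rule for `(0, 1, …, N)`, whose only interlacing tuple is `(0, 1, …, N - 1)`. -/
theorem vandermonde_det_castSucc {N : ℕ} (u : Fin (N + 1) → ℝ) :
    (Matrix.vandermonde u).det = (∏ i : Fin N, (u (Fin.last N) - u i.castSucc)) *
      (Matrix.vandermonde fun i => u i.castSucc).det := by
  have h : interlacing (minTuple (N + 1)) = {minTuple N} := by
    ext m
    simp only [interlacing, Fintype.mem_piFinset, Finset.mem_Ico, Finset.mem_singleton, minTuple,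
      funext_iff, Fin.val_castSucc, Fin.val_succ]
    exact forall_congr' fun i => by omega
  rw [← genVandermondeDet_minTuple, genVandermondeDet_succ _ _ (minTuple_strictMono _).monotone, h,
    Finset.sum_singleton, genVandermondeDet_minTuple]
  simp [minTuple]

theorem interlacing_strictMono {N : ℕ} {n : Fin (N + 1) → ℕ} (hn : Monotone n) {m : Fin N → ℕ}
    (hm : m ∈ interlacing n) : StrictMono m := by
  intro i j hij
  have hm' := Fintype.mem_piFinset.1 hm
  have h1 := (Finset.mem_Ico.1 (hm' i)).2
  have h2 := (Finset.mem_Ico.1 (hm' j)).1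
  have h3 : n i.succ ≤ n j.castSucc := hn (Fin.succ_le_castSucc_iff.2 hij)
  omega

theorem castSucc_mem_interlacing {N : ℕ} {n : Fin (N + 1) → ℕ} (hn : StrictMono n) :
    (fun i : Fin N => n i.castSucc) ∈ interlacing n := by
  simp only [interlacing, Fintype.mem_piFinset, Finset.mem_Ico]
  exact fun i => ⟨le_rfl, hn Fin.castSucc_lt_succ⟩

theorem pow_mul_prod_pow_sub {N : ℕ} (y : ℝ) (n : Fin (N + 1) → ℕ) (hn : Monotone n) :
    y ^ n 0 * ∏ j : Fin N, y ^ (n j.succ - n j.castSucc) = y ^ n (Fin.last N) := by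
  induction N with
  | zero => simp
  | succ N ih =>
    rw [Fin.prod_univ_castSucc, ← mul_assoc]
    have := ih (fun i => n i.castSucc) (fun i j h => hn (by simpa using h))
    simp only [Fin.castSucc_zero, ← Fin.succ_castSucc] at this ⊢
    rw [this, ← pow_add, Fin.succ_last]
    exact congrArg (y ^ ·) (Nat.add_sub_of_le (hn (Fin.le_last _)))

/-- Two-sided bound for a generalized Vandermonde determinant with increasing positive nodes:
it is comparable to the ordinary Vandermonde determinant times the leading monomial
`∏ u_i ^ (n_i - i)`. The factor `∏ u_i ^ i` is moved to the other side to avoid subtraction. -/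
theorem genVandermondeDet_bounds {N : ℕ} (u : Fin N → ℝ) (hu : ∀ i, 0 < u i) (hmono : Monotone u)
    (n : Fin N → ℕ) (hn : StrictMono n) :
    (Matrix.vandermonde u).det * ∏ i, u i ^ n i ≤
        genVandermondeDet u n * ∏ i : Fin N, u i ^ (i : ℕ) ∧
      genVandermondeDet u n * ∏ i : Fin N, u i ^ (i : ℕ) ≤
        chooseDet n * ((Matrix.vandermonde u).det * ∏ i, u i ^ n i) := by
  induction N with
  | zero => simp [genVandermondeDet, chooseDet]
  | succ N ih =>
    set y := u (Fin.last N) with hy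
    set v : Fin N → ℝ := fun i => u i.castSucc with hv
    have hy0 : 0 < y := hu _
    have hvy : ∀ i, v i ≤ y := fun i => hmono (Fin.le_last _)
    have hv0 : ∀ i, 0 < v i := fun i => hu _
    have hvmono : Monotone v := fun i j h => hmono (by simpa using h)
    have hP : 0 ≤ ∏ i : Fin N, (y - v i) :=
      Finset.prod_nonneg fun i _ => sub_nonneg.2 (hvy i)
    have hVv : 0 ≤ (Matrix.vandermonde v).det := by
      rw [Matrix.det_vandermonde]
      exact Finset.prod_nonneg fun i _ => Finset.prod_nonneg fun j hj =>
        sub_nonneg.2 (hvmono (Finset.mem_Ioi.1 hj).le)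
    -- the summand of the branching rule that belongs to `m`, times the part of the normalizing
    -- monomial it absorbs
    set T : (Fin N → ℕ) → ℝ := fun m => y ^ n 0 *
      ((genVandermondeDet v m * ∏ i : Fin N, v i ^ (i : ℕ)) *
        ∏ j : Fin N, y ^ (n j.succ - m j)) with hT
    have hD : genVandermondeDet u n * ∏ i : Fin (N + 1), u i ^ (i : ℕ) =
        (∏ i : Fin N, (y - v i)) * ∑ m ∈ interlacing n, T m := by
      rw [genVandermondeDet_succ u n hn.monotone, Fin.prod_univ_castSucc]
      simp only [Finset.mul_sum, Finset.sum_mul]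
      refine Finset.sum_congr rfl fun m hm => ?_
      have hm' := Fintype.mem_piFinset.1 hm
      have : ∏ j : Fin N, y ^ (n j.succ - m j) =
          (∏ j : Fin N, y ^ (n j.succ - 1 - m j)) * y ^ N := by
        have h2 : y ^ N = ∏ j : Fin N, y := by simp
        rw [h2, ← Finset.prod_mul_distrib]
        refine Finset.prod_congr rfl fun j _ => ?_
        rw [← pow_succ]
        have := (Finset.mem_Ico.1 (hm' j)).2
        congr 1
        omega
      simp only [hT, this, Fin.val_castSucc, Fin.val_last]
      ring
    have hmonom : y ^ n 0 * ((∏ i : Fin N, v i ^ n i.castSucc) *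
        ∏ j : Fin N, y ^ (n j.succ - n j.castSucc)) = ∏ i, u i ^ n i := by
      rw [Fin.prod_univ_castSucc, ← hy, ← pow_mul_prod_pow_sub y n hn.monotone]
      simp only [hv]
      ring
    have hpowle : ∀ m ∈ interlacing n, (∏ i : Fin N, v i ^ m i) *
        ∏ j : Fin N, y ^ (n j.succ - m j) ≤ (∏ i : Fin N, v i ^ n i.castSucc) *
        ∏ j : Fin N, y ^ (n j.succ - n j.castSucc) := by
      intro m hm
      have hm' := Fintype.mem_piFinset.1 hm
      rw [← Finset.prod_mul_distrib, ← Finset.prod_mul_distrib]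
      refine Finset.prod_le_prod
        (fun i _ => mul_nonneg (pow_nonneg (hv0 i).le _) (pow_nonneg hy0.le _)) fun i _ => ?_
      obtain ⟨h1, h2⟩ := Finset.mem_Ico.1 (hm' i)
      have e1 : m i = n i.castSucc + (m i - n i.castSucc) := by omega
      have e2 : n i.succ - n i.castSucc = (m i - n i.castSucc) + (n i.succ - m i) := by omega
      rw [e2, pow_add y]
      conv_lhs => rw [e1, pow_add (v i), ← e1]
      rw [mul_assoc]
      have := hv0 i
      gcongr
      exact hvy i
    have hlow0 : ∀ m ∈ interlacing n, 0 ≤ T m := by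
      intro m hm
      have := (ih v hv0 hvmono m (interlacing_strictMono hn.monotone hm)).1
      have h3 : 0 ≤ (Matrix.vandermonde v).det * ∏ i, v i ^ m i :=
        mul_nonneg hVv (Finset.prod_nonneg fun i _ => pow_nonneg (hv0 i).le _)
      exact mul_nonneg (pow_nonneg hy0.le _) (mul_nonneg (h3.trans this)
        (Finset.prod_nonneg fun i _ => pow_nonneg hy0.le _))
    have hupp : ∀ m ∈ interlacing n,
        T m ≤ chooseDet m * ((Matrix.vandermonde v).det * ∏ i, u i ^ n i) := by
      intro m hm
      have hms := interlacing_strictMono hn.monotone hm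
      have h1 := (ih v hv0 hvmono m hms).2
      calc T m ≤ y ^ n 0 * ((chooseDet m * ((Matrix.vandermonde v).det * ∏ i, v i ^ m i)) *
            ∏ j : Fin N, y ^ (n j.succ - m j)) := by
            simp only [hT]
            gcongr
        _ = y ^ n 0 * (chooseDet m * (Matrix.vandermonde v).det * ((∏ i : Fin N, v i ^ m i) *
            ∏ j : Fin N, y ^ (n j.succ - m j))) := by ring
        _ ≤ y ^ n 0 * (chooseDet m * (Matrix.vandermonde v).det *
            ((∏ i : Fin N, v i ^ n i.castSucc) *
            ∏ j : Fin N, y ^ (n j.succ - n j.castSucc))) := by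
            have h0 := mul_nonneg (chooseDet_pos hms).le hVv
            exact mul_le_mul_of_nonneg_left (mul_le_mul_of_nonneg_left (hpowle m hm) h0)
              (pow_nonneg hy0.le _)
        _ = _ := by rw [← hmonom]; ring
    rw [hD, vandermonde_det_castSucc, ← hy, ← hv]
    constructor
    · -- the tuple obtained by dropping the last exponent already contributes the leading monomial
      have h1 : (Matrix.vandermonde v).det * ∏ i, u i ^ n i ≤ ∑ m ∈ interlacing n, T m := by
        refine le_trans ?_ (Finset.single_le_sum hlow0 (castSucc_mem_interlacing hn))
        have := (ih v hv0 hvmono (fun i : Fin N => n i.castSucc)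
          (fun i j h => hn (by simpa using h))).1
        rw [← hmonom]
        calc _ = y ^ n 0 * (((Matrix.vandermonde v).det * ∏ i : Fin N, v i ^ n i.castSucc) *
              ∏ j : Fin N, y ^ (n j.succ - n j.castSucc)) := by ring
          _ ≤ _ := by
            simp only [hT]
            gcongr
      rw [mul_assoc]
      exact mul_le_mul_of_nonneg_left h1 hP
    · have h1 := Finset.sum_le_sum hupp
      rw [← Finset.sum_mul, ← chooseDet_succ n hn.monotone] at h1
      calc _ ≤ _ := mul_le_mul_of_nonneg_left h1 hP
        _ = _ := by ring

/-! ### The rank-one inequality -/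

theorem snoc_strictMono {N : ℕ} {n : Fin N → ℕ} (hn : StrictMono n) {M : ℕ} (hM : ∀ j, n j < M) :
    StrictMono (Fin.snoc n M : Fin (N + 1) → ℕ) := by
  intro i j hij
  induction j using Fin.lastCases with
  | last =>
    induction i using Fin.lastCases with
    | last => exact absurd hij (lt_irrefl _)
    | cast i => simpa using hM i
  | cast j =>
    induction i using Fin.lastCases with
    | last => exact absurd hij (Fin.le_last _).not_gt
    | cast i => simpa using hn (by simpa using hij)

theorem replaceTuple_strictMono {N : ℕ} {n : Fin N → ℕ} (hn : StrictMono n) {M : ℕ}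
    (hM : ∀ j, n j < M) (j : Fin N) : StrictMono (replaceTuple n M j) :=
  (snoc_strictMono hn hM).comp (Fin.strictMono_succAbove _)

theorem le_replaceTuple {N : ℕ} {n : Fin N → ℕ} (hn : StrictMono n) {M : ℕ}
    (hM : ∀ j, n j < M) (j i : Fin N) : n i ≤ replaceTuple n M j i := by
  have h : i.castSucc ≤ j.castSucc.succAbove i := by
    rw [Fin.succAbove]
    split_ifs
    exacts [le_rfl, Fin.castSucc_lt_succ.le]
  simpa [replaceTuple] using (snoc_strictMono hn hM).monotone h

theorem sum_replaceTuple {N : ℕ} (n : Fin N → ℕ) (M : ℕ) (j : Fin N) :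
    n j + ∑ i, replaceTuple n M j i = ∑ i, n i + M := by
  have h1 := Fin.sum_univ_succAbove (Fin.snoc n M : Fin (N + 1) → ℕ) j.castSucc
  rw [Fin.sum_univ_castSucc] at h1
  simpa [replaceTuple] using h1.symm

theorem threshold_eq_sum_chooseDet {N : ℕ} (n : Fin N → ℕ) (M : ℕ) (c : Fin N → ℝ) (ρ : ℝ) :
    threshold n M c ρ = ∑ j, chooseDet (replaceTuple n M j) ^ 2 * (ρ ^ (M - n j) / c j) := by
  simp only [threshold, chooseDet_eq_div, div_pow]

theorem threshold_nonneg {N : ℕ} (n : Fin N → ℕ) (M : ℕ) {c : Fin N → ℝ} (hc : ∀ j, 0 < c j)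
    {ρ : ℝ} (hρ : 0 < ρ) : 0 ≤ threshold n M c ρ := by
  rw [threshold_eq_sum_chooseDet]
  refine Finset.sum_nonneg fun j _ => ?_
  have := hc j
  positivity

theorem threshold_pos {N : ℕ} (hN : 0 < N) {n : Fin N → ℕ} (hn : StrictMono n) {M : ℕ}
    (hM : ∀ j, n j < M) {c : Fin N → ℝ} (hc : ∀ j, 0 < c j) {ρ : ℝ} (hρ : 0 < ρ) :
    0 < threshold n M c ρ := by
  rw [threshold_eq_sum_chooseDet]
  have : Nonempty (Fin N) := ⟨⟨0, hN⟩⟩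
  refine Finset.sum_pos (fun j _ => ?_) Finset.univ_nonempty
  have h1 := chooseDet_pos (replaceTuple_strictMono hn hM j)
  have := hc j
  positivity

/-- Cramer's rule expressing `u ^ M` through the powers `u ^ n_j`, read off from the vanishing
determinant of the `(N + 1) × (N + 1)` generalized Vandermonde matrix with a repeated node. -/
theorem genVandermondeDet_mul_pow {R : Type*} [CommRing R] {N : ℕ} (u : Fin N → R) (n : Fin N → ℕ)
    (M : ℕ) (i : Fin N) :
    genVandermondeDet u n * u i ^ M =
      ∑ j : Fin N, (-1) ^ (N + 1 + (j : ℕ)) * genVandermondeDet u (replaceTuple n M j) *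
        u i ^ n j := by
  let B : Matrix (Fin (N + 1)) (Fin (N + 1)) R := Matrix.of fun a b =>
    (Fin.cons (u i) u : Fin (N + 1) → R) a ^ (Fin.snoc n M : Fin (N + 1) → ℕ) b
  have h0 : B.det = 0 := by
    refine Matrix.det_zero_of_row_eq (i := 0) (j := i.succ) (Fin.succ_ne_zero i).symm ?_
    ext b
    simp [B]
  have hsub : ∀ j : Fin N, (B.submatrix Fin.succ j.castSucc.succAbove).det =
      genVandermondeDet u (replaceTuple n M j) := by
    intro j
    refine congrArg Matrix.det (Matrix.ext fun a b => ?_)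
    simp [B, replaceTuple]
  have hlast : (B.submatrix Fin.succ (Fin.last N).succAbove).det = genVandermondeDet u n := by
    refine congrArg Matrix.det (Matrix.ext fun a b => ?_)
    simp [B]
  have hB1 : ∀ j : Fin N, B 0 j.castSucc = u i ^ n j := fun j => by simp [B]
  have hB2 : B 0 (Fin.last N) = u i ^ M := by simp [B]
  rw [Matrix.det_succ_row_zero, Fin.sum_univ_castSucc] at h0
  simp only [hsub, hlast, hB1, hB2, Fin.val_castSucc, Fin.val_last] at h0
  have h1 : ((-1 : R) ^ N) * (-1) ^ N = 1 := by rw [← mul_pow]; simp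
  have h2 : ∑ j : Fin N, (-1) ^ (N + 1 + (j : ℕ)) * genVandermondeDet u (replaceTuple n M j) *
      u i ^ n j = - (-1) ^ N * ∑ j : Fin N, (-1) ^ (j : ℕ) * u i ^ n j *
        genVandermondeDet u (replaceTuple n M j) := by
    rw [Finset.mul_sum]
    refine Finset.sum_congr rfl fun j _ => ?_
    ring
  rw [h2]
  linear_combination (-1) ^ N * h0 - genVandermondeDet u n * u i ^ M * h1

theorem vandermonde_det_pos {N : ℕ} {u : Fin N → ℝ} (hu : StrictMono u) :
    0 < (Matrix.vandermonde u).det := by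
  rw [Matrix.det_vandermonde]
  exact Finset.prod_pos fun i _ => Finset.prod_pos fun j hj =>
    sub_pos.2 (hu (Finset.mem_Ioi.1 hj))

theorem genVandermondeDet_pos {N : ℕ} {u : Fin N → ℝ} (hu0 : ∀ i, 0 < u i) (hu : StrictMono u)
    {n : Fin N → ℕ} (hn : StrictMono n) : 0 < genVandermondeDet u n := by
  have h1 := (genVandermondeDet_bounds u hu0 hu.monotone n hn).1
  have h2 : 0 < ∏ i, u i ^ n i := Finset.prod_pos fun i _ => pow_pos (hu0 i) _
  have h3 : 0 < ∏ i : Fin N, u i ^ (i : ℕ) := Finset.prod_pos fun i _ => pow_pos (hu0 i) _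
  exact pos_of_mul_pos_left ((mul_pos (vandermonde_det_pos hu) h2).trans_le h1) h3.le

/-- Upper bound for the Cramer coefficients `D(n_j) / D(n)`: the monomials in the two-sided bounds
for numerator and denominator differ by a factor of degree `M - n j` in nodes that are at most
`r`. -/
theorem genVandermondeDet_replaceTuple_le {N : ℕ} {u : Fin N → ℝ} {r : ℝ} (hu0 : ∀ i, 0 < u i)
    (hur : ∀ i, u i ≤ r) (hu : StrictMono u) {n : Fin N → ℕ} (hn : StrictMono n) {M : ℕ}
    (hM : ∀ j, n j < M) (j : Fin N) :
    genVandermondeDet u (replaceTuple n M j) ≤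
      chooseDet (replaceTuple n M j) * r ^ (M - n j) * genVandermondeDet u n := by
  have h3 : 0 < ∏ i : Fin N, u i ^ (i : ℕ) := Finset.prod_pos fun i _ => pow_pos (hu0 i) _
  have hr := replaceTuple_strictMono hn hM j
  have hV := vandermonde_det_pos hu
  have hprod : ∏ i, u i ^ replaceTuple n M j i ≤ (∏ i, u i ^ n i) * r ^ (M - n j) := by
    have hsum : M - n j = ∑ i, (replaceTuple n M j i - n i) := by
      have h1 := sum_replaceTuple n M j
      have h2 : ∑ i, replaceTuple n M j i = ∑ i, n i + ∑ i, (replaceTuple n M j i - n i) := by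
        rw [← Finset.sum_add_distrib]
        exact Finset.sum_congr rfl fun i _ => (Nat.add_sub_of_le (le_replaceTuple hn hM j i)).symm
      have := hM j
      omega
    rw [hsum, ← Finset.prod_pow_eq_pow_sum, ← Finset.prod_mul_distrib]
    refine Finset.prod_le_prod (fun i _ => pow_nonneg (hu0 i).le _) fun i _ => ?_
    conv_lhs => rw [← Nat.add_sub_of_le (le_replaceTuple hn hM j i), pow_add]
    have := hu0 i
    gcongr
    exact hur i
  have hr0 : 0 ≤ r := (hu0 j).le.trans (hur j)
  have hW := (chooseDet_pos hr).le
  refine le_of_mul_le_mul_right ?_ h3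
  calc _ ≤ _ := (genVandermondeDet_bounds u hu0 hu.monotone _ hr).2
    _ ≤ chooseDet (replaceTuple n M j) * ((Matrix.vandermonde u).det *
        ((∏ i, u i ^ n i) * r ^ (M - n j))) := by gcongr
    _ = chooseDet (replaceTuple n M j) * r ^ (M - n j) *
        ((Matrix.vandermonde u).det * ∏ i, u i ^ n i) := by ring
    _ ≤ chooseDet (replaceTuple n M j) * r ^ (M - n j) *
        (genVandermondeDet u n * ∏ i : Fin N, u i ^ (i : ℕ)) := by
        exact mul_le_mul_of_nonneg_left (genVandermondeDet_bounds u hu0 hu.monotone n hn).1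
          (by positivity)
    _ = _ := by ring

/-- The rank-one inequality, as an inequality of quadratic forms, for increasing nodes. -/
theorem rankOne_of_strictMono {N : ℕ} {u : Fin N → ℝ} {ρ : ℝ} (hρ : 0 < ρ) (hu0 : ∀ i, 0 < u i)
    (hur : ∀ i, u i ≤ √ρ) (hu : StrictMono u) {n : Fin N → ℕ} (hn : StrictMono n) {M : ℕ}
    (hM : ∀ j, n j < M) {c : Fin N → ℝ} (hc : ∀ j, 0 < c j) (x : Fin N → ℝ) :
    (∑ i, x i * u i ^ M) ^ 2 ≤
      threshold n M c ρ * ∑ j, c j * (∑ i, x i * u i ^ n j) ^ 2 := by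
  set D := genVandermondeDet u n with hD
  have hD0 : 0 < D := genVandermondeDet_pos hu0 hu hn
  set E : Fin N → ℝ := fun j =>
    (-1) ^ (N + 1 + (j : ℕ)) * genVandermondeDet u (replaceTuple n M j) with hE
  set S : Fin N → ℝ := fun j => ∑ i, x i * u i ^ n j with hS
  have hexp : D * ∑ i, x i * u i ^ M = ∑ j, E j * S j := by
    simp only [hS, Finset.mul_sum]
    rw [Finset.sum_comm]
    refine Finset.sum_congr rfl fun i _ => ?_
    rw [mul_left_comm, hD, genVandermondeDet_mul_pow, Finset.mul_sum]
    exact Finset.sum_congr rfl fun j _ => by simp only [hE]; ring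
  have hCS : (∑ j, E j * S j) ^ 2 ≤ (∑ j, E j ^ 2 / c j) * ∑ j, c j * S j ^ 2 := by
    refine Finset.sum_sq_le_sum_mul_sum_of_sq_le_mul _ (fun j _ => ?_) (fun j _ => ?_)
      (fun j _ => ?_)
    · have := hc j
      positivity
    · have := hc j
      positivity
    · have := (hc j).ne'
      exact le_of_eq (by field_simp)
  have hEle : ∑ j, E j ^ 2 / c j ≤ D ^ 2 * threshold n M c ρ := by
    rw [threshold_eq_sum_chooseDet, Finset.mul_sum]
    refine Finset.sum_le_sum fun j _ => ?_
    have h1 := genVandermondeDet_replaceTuple_le hu0 hur hu hn hM j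
    have h2 := (genVandermondeDet_pos hu0 hu (replaceTuple_strictMono hn hM j)).le
    have h3 : E j ^ 2 = genVandermondeDet u (replaceTuple n M j) ^ 2 := by
      simp only [hE, mul_pow, ← pow_mul, mul_comm _ 2]
      simp [pow_mul]
    have h4 : E j ^ 2 ≤ D ^ 2 * (chooseDet (replaceTuple n M j) ^ 2 * ρ ^ (M - n j)) := by
      rw [h3]
      calc _ ≤ (chooseDet (replaceTuple n M j) * √ρ ^ (M - n j) * D) ^ 2 := by gcongr
        _ = D ^ 2 * (chooseDet (replaceTuple n M j) ^ 2 * (√ρ ^ 2) ^ (M - n j)) := by ring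
        _ = _ := by rw [Real.sq_sqrt hρ.le]
    calc E j ^ 2 / c j ≤ D ^ 2 * (chooseDet (replaceTuple n M j) ^ 2 * ρ ^ (M - n j)) / c j := by
          have := hc j
          gcongr
      _ = _ := by ring
  have hQ : 0 ≤ ∑ j, c j * S j ^ 2 :=
    Finset.sum_nonneg fun j _ => mul_nonneg (hc j).le (sq_nonneg _)
  have hfin : D ^ 2 * (∑ i, x i * u i ^ M) ^ 2 ≤
      D ^ 2 * (threshold n M c ρ * ∑ j, c j * S j ^ 2) := by
    rw [← mul_pow, hexp, ← mul_assoc]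
    exact hCS.trans (mul_le_mul_of_nonneg_right hEle hQ)
  exact le_of_mul_le_mul_left hfin (by positivity)

/-- Repeated nodes are allowed at the cost of strict inequality `u i < √ρ`. -/
theorem rankOne_of_monotone {N : ℕ} {u : Fin N → ℝ} {ρ : ℝ} (hρ : 0 < ρ) (hu0 : ∀ i, 0 < u i)
    (hur : ∀ i, u i < √ρ) (hu : Monotone u) {n : Fin N → ℕ} (hn : StrictMono n) {M : ℕ}
    (hM : ∀ j, n j < M) {c : Fin N → ℝ} (hc : ∀ j, 0 < c j) (x : Fin N → ℝ) :
    (∑ i, x i * u i ^ M) ^ 2 ≤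
      threshold n M c ρ * ∑ j, c j * (∑ i, x i * u i ^ n j) ^ 2 := by
  -- separate the nodes by `ε * i` and let `ε` tend to `0` from the right
  set w : ℝ → Fin N → ℝ := fun ε i => u i + ε * (i : ℕ) with hw
  have hev : ∀ᶠ ε in nhdsWithin (0 : ℝ) (Set.Ioi 0), ∀ i, w ε i ≤ √ρ := by
    refine Filter.eventually_all.2 fun i => ?_
    have hc : ContinuousAt (fun ε : ℝ => w ε i) 0 := by
      simp only [hw]
      fun_prop
    have h0 : w 0 i < √ρ := by simpa [hw] using hur i
    exact ((hc.eventually_lt continuousAt_const h0).filter_mono nhdsWithin_le_nhds).mono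
      fun _ h => h.le
  have hL : Filter.Tendsto (fun ε => (∑ i, x i * w ε i ^ M) ^ 2) (nhdsWithin (0 : ℝ) (Set.Ioi 0))
      (nhds ((∑ i, x i * u i ^ M) ^ 2)) := by
    have : Continuous fun ε => (∑ i, x i * w ε i ^ M) ^ 2 := by
      simp only [hw]
      fun_prop
    simpa [hw] using (this.tendsto 0).mono_left nhdsWithin_le_nhds
  have hR : Filter.Tendsto
      (fun ε => threshold n M c ρ * ∑ j, c j * (∑ i, x i * w ε i ^ n j) ^ 2)
      (nhdsWithin (0 : ℝ) (Set.Ioi 0))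
      (nhds (threshold n M c ρ * ∑ j, c j * (∑ i, x i * u i ^ n j) ^ 2)) := by
    have : Continuous
        fun ε => threshold n M c ρ * ∑ j, c j * (∑ i, x i * w ε i ^ n j) ^ 2 := by
      simp only [hw]
      fun_prop
    simpa [hw] using (this.tendsto 0).mono_left nhdsWithin_le_nhds
  refine le_of_tendsto_of_tendsto hL hR ?_
  filter_upwards [hev, self_mem_nhdsWithin] with ε hε hpos
  have hpos' : (0 : ℝ) < ε := hpos
  refine rankOne_of_strictMono hρ (fun i => ?_) hε (fun i j hij => ?_) hn hM hc x
  · have := hu0 i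
    simp only [hw]
    positivity
  · have h1 : ((i : ℕ) : ℝ) < (j : ℕ) := by exact_mod_cast hij
    exact add_lt_add_of_le_of_lt (hu hij.le) (mul_lt_mul_of_pos_left h1 hpos')

/-- The rank-one inequality without an ordering of the nodes: both sides are invariant under a
simultaneous permutation of `u` and `x`. -/
theorem rankOne_inequality {N : ℕ} {u : Fin N → ℝ} {ρ : ℝ} (hρ : 0 < ρ) (hu0 : ∀ i, 0 < u i)
    (hur : ∀ i, u i < √ρ) {n : Fin N → ℕ} (hn : StrictMono n) {M : ℕ}
    (hM : ∀ j, n j < M) {c : Fin N → ℝ} (hc : ∀ j, 0 < c j) (x : Fin N → ℝ) :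
    (∑ i, x i * u i ^ M) ^ 2 ≤
      threshold n M c ρ * ∑ j, c j * (∑ i, x i * u i ^ n j) ^ 2 := by
  have h := rankOne_of_monotone hρ (fun i => hu0 (Tuple.sort u i)) (fun i => hur (Tuple.sort u i))
    (Tuple.monotone_sort u) hn hM hc (fun i => x (Tuple.sort u i))
  have e : ∀ k : ℕ, ∑ i, x (Tuple.sort u i) * u (Tuple.sort u i) ^ k = ∑ i, x i * u i ^ k :=
    fun k => Equiv.sum_comp (Tuple.sort u) fun i => x i * u i ^ k
  simpa only [e] using h

/-! ### The extension principle -/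

theorem posSemidef_iff_sum {N : ℕ} {A : Matrix (Fin N) (Fin N) ℝ} :
    A.PosSemidef ↔ A.IsSymm ∧ ∀ x : Fin N → ℝ, 0 ≤ ∑ i, ∑ k, x i * A i k * x k := by
  have h : ∀ x : Fin N → ℝ, star x ⬝ᵥ (A.mulVec x) = ∑ i, ∑ k, x i * A i k * x k := by
    intro x
    simp [dotProduct, Matrix.mulVec, Finset.mul_sum, mul_assoc]
  rw [Matrix.posSemidef_iff_dotProduct_mulVec]
  simp only [h, Matrix.IsHermitian, Matrix.conjTranspose_eq_transpose_of_trivial, Matrix.IsSymm]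

theorem vecMulVec_posSemidef {N : ℕ} (u : Fin N → ℝ) :
    (Matrix.of fun i k => u i * u k).PosSemidef := by
  rw [posSemidef_iff_sum]
  refine ⟨Matrix.IsSymm.ext fun i k => by simp [mul_comm], fun x => ?_⟩
  have : ∑ i, ∑ k, x i * (Matrix.of fun i k => u i * u k) i k * x k = (∑ i, x i * u i) ^ 2 := by
    rw [sq, Finset.sum_mul_sum]
    refine Finset.sum_congr rfl fun i _ => Finset.sum_congr rfl fun k _ => ?_
    simp only [Matrix.of_apply]
    ring
  rw [this]
  positivity

theorem hadamardPow_posSemidef {N : ℕ} {A : Matrix (Fin N) (Fin N) ℝ} (hA : A.PosSemidef) (m : ℕ) :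
    (hadamardPow A m).PosSemidef := by
  induction m with
  | zero =>
    have := vecMulVec_posSemidef (fun _ : Fin N => (1 : ℝ))
    refine (congrArg Matrix.PosSemidef (Matrix.ext fun i k => ?_)).mp this
    simp [hadamardPow]
  | succ m ih =>
    refine (congrArg Matrix.PosSemidef (Matrix.ext fun i k => ?_)).mp (ih.hadamard hA)
    simp [hadamardPow, pow_succ]

/-- Schur complement of the `(0, 0)` entry, as a matrix of the original size. -/
theorem schurComplement_posSemidef {N : ℕ} {A : Matrix (Fin (N + 1)) (Fin (N + 1)) ℝ}
    (hA : A.PosSemidef) (h0 : 0 < A 0 0) :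
    (A - Matrix.of fun i k => A i 0 * A k 0 / A 0 0).PosSemidef := by
  rw [posSemidef_iff_sum] at hA ⊢
  obtain ⟨hs, hq⟩ := hA
  refine ⟨Matrix.IsSymm.ext fun i k => ?_, fun x => ?_⟩
  · simp only [Matrix.sub_apply, Matrix.of_apply, hs.apply i k]
    ring
  · -- evaluate the form of `A` at `x - s • e₀`, where `s` minimizes it
    set s := (∑ i, x i * A i 0) / A 0 0 with hsdef
    have h := hq (fun i => x i - s * (if i = 0 then 1 else 0))
    have hlin : ∑ i, x i * A i 0 = s * A 0 0 := by rw [hsdef]; field_simp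
    have hlin' : ∑ k, A 0 k * x k = s * A 0 0 := by
      rw [← hlin]
      exact Finset.sum_congr rfl fun k _ => by rw [hs.apply k 0]; ring
    have e1 : ∑ i, ∑ k, (x i - s * (if i = 0 then 1 else 0)) * A i k *
        (x k - s * (if k = 0 then 1 else 0)) =
        ∑ i, ∑ k, x i * A i k * x k - s ^ 2 * A 0 0 := by
      have : ∀ i k, (x i - s * (if i = 0 then 1 else 0)) * A i k *
          (x k - s * (if k = 0 then 1 else 0)) = x i * A i k * x k
          - s * (if k = 0 then x i * A i k else 0) - s * (if i = 0 then A i k * x k else 0)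
          + s ^ 2 * (if i = 0 then (if k = 0 then A i k else 0) else 0) := by
        intro i k
        split_ifs <;> ring
      simp only [this, Finset.sum_add_distrib, Finset.sum_sub_distrib, ← Finset.mul_sum]
      have e3 : ∑ i : Fin (N + 1), ∑ k, (if i = 0 then A i k * x k else 0) = s * A 0 0 := by
        rw [Finset.sum_comm]
        simpa using hlin'
      have e4 : ∑ i : Fin (N + 1), ∑ k : Fin (N + 1),
          (if i = 0 then (if k = 0 then A i k else 0) else 0) = A 0 0 := by
        rw [Finset.sum_comm]
        simp
      rw [e3, e4]
      simp only [Finset.sum_ite_eq', Finset.mem_univ, if_true, hlin]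
      ring
    have e2 : ∑ i, ∑ k, x i * (A - Matrix.of fun i k => A i 0 * A k 0 / A 0 0) i k * x k =
        ∑ i, ∑ k, x i * A i k * x k - s ^ 2 * A 0 0 := by
      have : s ^ 2 * A 0 0 = ∑ i, ∑ k, x i * (A i 0 * A k 0 / A 0 0) * x k := by
        have : s ^ 2 * A 0 0 = (∑ i, x i * A i 0) * (∑ i, x i * A i 0) / A 0 0 := by
          rw [hlin]
          field_simp
        rw [this, Finset.sum_mul_sum, Finset.sum_div]
        refine Finset.sum_congr rfl fun i _ => ?_
        rw [Finset.sum_div]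
        exact Finset.sum_congr rfl fun k _ => by ring
      rw [this, ← Finset.sum_sub_distrib]
      refine Finset.sum_congr rfl fun i _ => ?_
      rw [← Finset.sum_sub_distrib]
      refine Finset.sum_congr rfl fun k _ => ?_
      simp only [Matrix.sub_apply, Matrix.of_apply]
      ring
    rw [e2, ← e1]
    exact h

/-- Extension principle: a function that is positivity preserving on rank-one matrices, and whose
derivative preserves positivity in dimension one less, preserves positivity. Along the segment from
the rank-one matrix `Z` with the same first row and column as `A` to `A`, the quadratic form of the
entrywise image is monotone, because its derivative is the quadratic form of a Schur product. -/
theorem entrywisePreservesPositivity_succ {N : ℕ} {f f' : ℝ → ℝ} {ρ : ℝ}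
    (hd : ∀ x ∈ Set.Ioo 0 ρ, HasDerivAt f (f' x) x)
    (h1 : ∀ u : Fin (N + 1) → ℝ, (∀ i, 0 < u i) → (∀ i, u i < √ρ) →
      (Matrix.of fun i k => f (u i * u k)).PosSemidef)
    (h' : EntrywisePreservesPositivity f' (psdMatrices N (Set.Ioo 0 ρ))) :
    EntrywisePreservesPositivity f (psdMatrices (N + 1) (Set.Ioo 0 ρ)) := by
  rintro A ⟨hA, hAI⟩
  have h00 : 0 < A 0 0 := (hAI 0 0).1
  have hs : A.IsSymm := (posSemidef_iff_sum.1 hA).1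
  set ζ : Fin (N + 1) → ℝ := fun i => A i 0 / √(A 0 0) with hζ
  set Z : Matrix (Fin (N + 1)) (Fin (N + 1)) ℝ := Matrix.of fun i k => ζ i * ζ k with hZ
  have hZA : Z = Matrix.of fun i k => A i 0 * A k 0 / A 0 0 := by
    ext i k
    simp only [hZ, hζ, Matrix.of_apply]
    rw [div_mul_div_comm, Real.mul_self_sqrt h00.le]
  have hζ0 : ∀ i, 0 < ζ i := fun i => div_pos (hAI i 0).1 (Real.sqrt_pos.2 h00)
  have hC : (A - Z).PosSemidef := by
    rw [hZA]
    exact schurComplement_posSemidef hA h00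
  have hζρ : ∀ i, ζ i < √ρ := by
    intro i
    have h := hC.diag_nonneg (i := i)
    simp only [Matrix.sub_apply, hZ, Matrix.of_apply] at h
    refine Real.lt_sqrt_of_sq_lt ?_
    have := (hAI i i).2
    nlinarith
  have hρ : 0 < ρ := (hAI 0 0).1.trans (hAI 0 0).2
  have hZI : ∀ i k, Z i k ∈ Set.Ioo 0 ρ := by
    intro i k
    refine ⟨mul_pos (hζ0 i) (hζ0 k), ?_⟩
    calc Z i k < √ρ * √ρ := mul_lt_mul'' (hζρ i) (hζρ k) (hζ0 i).le (hζ0 k).le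
      _ = ρ := Real.mul_self_sqrt hρ.le
  have hZpsd : Z.PosSemidef := vecMulVec_posSemidef ζ
  have hC0 : ∀ i, (A - Z) i 0 = 0 := by
    intro i
    rw [hZA]
    simp only [Matrix.sub_apply, Matrix.of_apply]
    field_simp
    ring
  have hC0' : ∀ k, (A - Z) 0 k = 0 := by
    intro k
    rw [hZA]
    simp only [Matrix.sub_apply, Matrix.of_apply, hs.apply k 0]
    field_simp
    ring
  set L : ℝ → Matrix (Fin (N + 1)) (Fin (N + 1)) ℝ := fun t => Z + t • (A - Z) with hL
  have hLI : ∀ t ∈ Set.Icc (0 : ℝ) 1, ∀ i k, L t i k ∈ Set.Ioo 0 ρ := by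
    intro t ht i k
    exact (convex_Ioo 0 ρ).add_smul_sub_mem (hZI i k) (hAI i k) ht
  have hLpsd : ∀ t ∈ Set.Icc (0 : ℝ) 1, (L t).PosSemidef := fun t ht =>
    hZpsd.add (hC.smul ht.1)
  rw [posSemidef_iff_sum]
  refine ⟨Matrix.IsSymm.ext fun i k => by simp [hs.apply i k], fun x => ?_⟩
  set g : ℝ → ℝ := fun t => ∑ i, ∑ k, x i * f (L t i k) * x k with hg
  have hgd : ∀ t ∈ Set.Icc (0 : ℝ) 1,
      HasDerivAt g (∑ i, ∑ k, x i * (f' (L t i k) * (A - Z) i k) * x k) t := by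
    intro t ht
    refine HasDerivAt.fun_sum fun i _ => HasDerivAt.fun_sum fun k _ => ?_
    have h2 : HasDerivAt (fun t => L t i k) ((A - Z) i k) t := by
      simpa [hL] using ((hasDerivAt_id t).mul_const ((A - Z) i k)).const_add (Z i k)
    exact (((hd _ (hLI t ht i k)).comp t h2).const_mul (x i)).mul_const (x k)
  have hgnn : ∀ t ∈ Set.Icc (0 : ℝ) 1,
      0 ≤ ∑ i, ∑ k, x i * (f' (L t i k) * (A - Z) i k) * x k := by
    intro t ht
    have hmem : (L t).submatrix Fin.succ Fin.succ ∈ psdMatrices N (Set.Ioo 0 ρ) :=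
      ⟨(hLpsd t ht).submatrix _, fun i k => hLI t ht _ _⟩
    have hH := (h' _ hmem).hadamard (hC.submatrix Fin.succ)
    have h3 := (posSemidef_iff_sum.1 hH).2 (fun i => x i.succ)
    rw [Fin.sum_univ_succ]
    simp only [Fin.sum_univ_succ (n := N), hC0, hC0', mul_zero, zero_mul, Finset.sum_const_zero,
      zero_add]
    simpa [Matrix.hadamard] using h3
  have hmono : MonotoneOn g (Set.Icc 0 1) := by
    refine monotoneOn_of_deriv_nonneg (convex_Icc 0 1)
      (fun t ht => (hgd t ht).continuousAt.continuousWithinAt) (fun t ht => ?_) (fun t ht => ?_)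
    · exact (hgd t (interior_subset ht)).differentiableAt.differentiableWithinAt
    · rw [(hgd t (interior_subset ht)).deriv]
      exact hgnn t (interior_subset ht)
  have h01 : g 0 ≤ g 1 := hmono (by simp) (by simp) zero_le_one
  have hg0 : 0 ≤ g 0 := by
    have := (posSemidef_iff_sum.1 (h1 ζ hζ0 hζρ)).2 x
    simpa [hg, hL, hZ] using this
  have hg1 : g 1 = ∑ i, ∑ k, x i * (A.map f) i k * x k := by simp [hg, hL]
  rw [← hg1]
  exact hg0.trans h01

/-! ### Comparison of thresholds in consecutive dimensions -/

theorem snoc_succ {N : ℕ} (n : Fin (N + 1) → ℕ) (M : ℕ) (k : Fin (N + 1)) :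
    (Fin.snoc n M : Fin (N + 2) → ℕ) k.succ =
      (Fin.snoc (fun i : Fin N => n i.succ) M : Fin (N + 1) → ℕ) k := by
  induction k using Fin.lastCases with
  | last => simp
  | cast k => rw [Fin.succ_castSucc]; simp only [Fin.snoc_castSucc]

theorem replaceTuple_succ_zero {N : ℕ} (n : Fin (N + 1) → ℕ) (M : ℕ) (j : Fin N) :
    replaceTuple n M j.succ 0 = n 0 := by
  rw [replaceTuple, Fin.castSucc_succ, Fin.succ_succAbove_zero]
  exact Fin.snoc_castSucc (α := fun _ => ℕ) M n 0

theorem replaceTuple_succ_succ {N : ℕ} (n : Fin (N + 1) → ℕ) (M : ℕ) (j i : Fin N) :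
    replaceTuple n M j.succ i.succ = replaceTuple (fun i => n i.succ) M j i := by
  rw [replaceTuple, Fin.castSucc_succ, Fin.succ_succAbove_succ, snoc_succ]
  rfl

theorem replaceTuple_sub_one {N : ℕ} (n : Fin N → ℕ) (M : ℕ) (j i : Fin N) :
    replaceTuple (fun i => n i - 1) (M - 1) j i = replaceTuple n M j i - 1 := by
  simp only [replaceTuple]
  induction j.castSucc.succAbove i using Fin.lastCases with
  | last => simp
  | cast k => simp

/-- Split off the differences with the first entry; the shift by `1` of the other entries does not
change their Vandermonde determinant, and `1 ≤ r i.succ` makes the subtraction genuine. -/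
theorem vandermondeDet_succ {N : ℕ} (r : Fin (N + 1) → ℕ) (hr : StrictMono r) :
    vandermondeDet r = (∏ i : Fin N, (((r i.succ - r 0 : ℕ)) : ℝ)) *
      vandermondeDet (fun i : Fin N => r i.succ - 1) := by
  have h1 : ∀ i : Fin N, ((r i.succ - 1 : ℕ) : ℝ) = r i.succ - 1 := fun i => by
    have : r 0 < r i.succ := hr (Fin.succ_pos i)
    rw [Nat.cast_sub (by omega)]
    simp
  have h2 : ∀ i : Fin N, ((r i.succ - r 0 : ℕ) : ℝ) = r i.succ - r 0 := fun i =>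
    Nat.cast_sub (hr (Fin.succ_pos i)).le
  simp only [vandermondeDet, Matrix.det_vandermonde, Fin.prod_univ_succ, Fin.prod_Ioi_zero,
    Fin.prod_Ioi_succ, h1, h2, sub_sub_sub_cancel_right]

theorem vandermondeDet_minTuple_succ (N : ℕ) :
    vandermondeDet (minTuple (N + 1)) = (N.factorial : ℝ) * vandermondeDet (minTuple N) := by
  rw [vandermondeDet_succ _ (minTuple_strictMono _)]
  congr 1
  rw [← Finset.prod_range_add_one_eq_factorial, ← Fin.prod_univ_eq_prod_range (fun i => i + 1) N]
  simp [minTuple]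

theorem add_one_le_of_strictMono {N : ℕ} {b : Fin N → ℕ} (hb : StrictMono b) (h0 : ∀ i, 0 < b i)
    (i : Fin N) : (i : ℕ) + 1 ≤ b i := by
  obtain ⟨k, hk⟩ := i
  induction k with
  | zero => exact h0 _
  | succ k ih =>
    have h1 := ih (by omega)
    have h2 : b ⟨k, by omega⟩ < b ⟨k + 1, hk⟩ := hb (by simp)
    simp only at h1 h2 ⊢
    omega

theorem factorial_le_prod {N : ℕ} {b : Fin N → ℕ} (hb : StrictMono b) (h0 : ∀ i, 0 < b i) :
    N.factorial ≤ ∏ i, b i := by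
  rw [← Finset.prod_range_add_one_eq_factorial, ← Fin.prod_univ_eq_prod_range (fun i => i + 1) N]
  exact Finset.prod_le_prod' fun i _ => add_one_le_of_strictMono hb h0 i

/-- The arithmetic behind the induction on the dimension. Writing `P` for the product below, both
`P * (n j - a)` and `P / (M - a)` are products of distinct positive integers, of `N + 1` and `N - 1`
factors, hence at least `(N + 1)!` and `(N - 1)!`. -/
theorem factorial_sq_mul_le {N : ℕ} {n : Fin N → ℕ} (hn : StrictMono n) {M : ℕ}
    (hM : ∀ j, n j < M) {a : ℕ} (ha : ∀ j, a < n j) (j : Fin N) :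
    N.factorial ^ 2 * M ≤ (∏ i, (replaceTuple n M j i - a)) ^ 2 * n j := by
  have haM : a < M := (ha j).trans (hM j)
  set B : Fin (N + 1) → ℕ := fun k => (Fin.snoc n M : Fin (N + 1) → ℕ) k - a with hB
  have hlt : ∀ k, a < (Fin.snoc n M : Fin (N + 1) → ℕ) k := by
    intro k
    induction k using Fin.lastCases with
    | last => simpa using haM
    | cast k => simpa using ha k
  have hB0 : ∀ k, 0 < B k := fun k => Nat.sub_pos_of_lt (hlt k)
  have hBm : StrictMono B := fun k l hkl => by
    have h1 := snoc_strictMono hn hM hkl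
    have h2 := hlt k
    simp only [hB]
    omega
  set q : Fin N → ℕ := fun i => B (j.castSucc.succAbove i) with hq
  have hqm : StrictMono q := hBm.comp (Fin.strictMono_succAbove _)
  have hq0 : ∀ i, 0 < q i := fun i => hB0 _
  change N.factorial ^ 2 * M ≤ (∏ i, q i) ^ 2 * n j
  have hP1 : N.factorial ≤ ∏ i, q i := factorial_le_prod hqm hq0
  have hP2 : (N + 1).factorial ≤ (n j - a) * ∏ i, q i := by
    have h1 := factorial_le_prod hBm hB0
    rw [Fin.prod_univ_succAbove _ j.castSucc] at h1
    simpa [hB] using h1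
  obtain ⟨K, rfl⟩ : ∃ K, N = K + 1 := ⟨N - 1, by have := j.isLt; omega⟩
  have hP3 : K.factorial * (M - a) ≤ ∏ i, q i := by
    rw [Fin.prod_univ_castSucc]
    refine Nat.mul_le_mul (factorial_le_prod (fun i k h => hqm (by simpa using h))
      fun i => hq0 _) (le_of_eq ?_)
    have h5 : j.castSucc.succAbove (Fin.last K) = Fin.last (K + 1) := by
      rw [Fin.succAbove_of_le_castSucc _ _ (by simpa using Fin.le_last j), Fin.succ_last]
    simp [hq, hB, h5]
  set P := ∏ i, q i
  have h4 := Nat.mul_le_mul hP2 hP3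
  have h5 : (K + 1).factorial ^ 2 ≤ (K + 1 + 1).factorial * K.factorial := by
    have e1 := Nat.factorial_succ (K + 1)
    have e2 := Nat.factorial_succ K
    rw [e1]
    calc (K + 1).factorial ^ 2 = (K + 1) * (K + 1).factorial * K.factorial := by
          rw [sq]
          nth_rewrite 2 [e2]
          ring
      _ ≤ _ := by gcongr; omega
  have h6 : (K + 1).factorial ^ 2 * (M - a) ≤ P ^ 2 * (n j - a) := by
    calc _ ≤ (K + 1 + 1).factorial * K.factorial * (M - a) := Nat.mul_le_mul_right _ h5
      _ = (K + 1 + 1).factorial * (K.factorial * (M - a)) := by ring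
      _ ≤ (n j - a) * P * P := h4
      _ = _ := by ring
  have h7 : (K + 1).factorial ^ 2 * a ≤ P ^ 2 * a := by gcongr
  calc (K + 1).factorial ^ 2 * M = (K + 1).factorial ^ 2 * (M - a) + (K + 1).factorial ^ 2 * a := by
        rw [← mul_add, Nat.sub_add_cancel haM.le]
    _ ≤ P ^ 2 * (n j - a) + P ^ 2 * a := add_le_add h6 h7
    _ = P ^ 2 * n j := by rw [← mul_add, Nat.sub_add_cancel (ha j).le]

/-- The threshold dominates the threshold of the derivative with its lowest term dropped. -/
theorem mul_threshold_derivative_le {N : ℕ} {n : Fin (N + 1) → ℕ} (hn : StrictMono n) {M : ℕ}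
    (hM : ∀ j, n j < M) {c : Fin (N + 1) → ℝ} (hc : ∀ j, 0 < c j) {ρ : ℝ} (hρ : 0 < ρ) :
    M * threshold (fun j : Fin N => n j.succ - 1) (M - 1) (fun j => c j.succ * n j.succ) ρ ≤
      threshold n M c ρ := by
  have hn1 : ∀ j : Fin N, n 0 < n j.succ := fun j => hn (Fin.succ_pos j)
  have hns : StrictMono fun j : Fin N => n j.succ := fun i j h => hn (by simpa using h)
  rw [threshold, threshold, Fin.sum_univ_succ, Finset.mul_sum]
  refine le_add_of_nonneg_of_le ?_ (Finset.sum_le_sum fun j _ => ?_)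
  · have := hc 0
    positivity
  · set P : ℕ := ∏ i, (replaceTuple (fun i => n i.succ) M j i - n 0) with hP
    have hkey := factorial_sq_mul_le hns (fun j => hM j.succ) hn1 j
    rw [← hP] at hkey
    have hkey' : ((N.factorial : ℝ)) ^ 2 * M ≤ (P : ℝ) ^ 2 * n j.succ := by exact_mod_cast hkey
    have hV : vandermondeDet (replaceTuple n M j.succ) = P *
        vandermondeDet (replaceTuple (fun j : Fin N => n j.succ - 1) (M - 1) j) := by
      rw [vandermondeDet_succ _ (replaceTuple_strictMono hn hM _)]
      simp only [replaceTuple_succ_zero, replaceTuple_succ_succ, hP, Nat.cast_prod]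
      congr 2
      ext i
      rw [replaceTuple_sub_one]
    have hexp : M - 1 - (n j.succ - 1) = M - n j.succ := by
      have := hn1 j
      omega
    rw [hV, vandermondeDet_minTuple_succ, hexp]
    have hV0 := vandermondeDet_pos (minTuple_strictMono N)
    set v := vandermondeDet (minTuple N)
    set w := vandermondeDet (replaceTuple (fun j : Fin N => n j.succ - 1) (M - 1) j)
    have hcj := hc j.succ
    have hnj : (0 : ℝ) < n j.succ := by
      have := hn1 j
      exact_mod_cast (by omega : 0 < n j.succ)
    have hF : (0 : ℝ) < N.factorial := by exact_mod_cast N.factorial_pos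
    have e : (P * w) ^ 2 / (N.factorial * v) ^ 2 * (ρ ^ (M - n j.succ) / c j.succ) =
        (w ^ 2 / v ^ 2 * (ρ ^ (M - n j.succ) / c j.succ)) * ((P : ℝ) ^ 2 / N.factorial ^ 2) := by
      field_simp
    have e' : M * (w ^ 2 / v ^ 2 * (ρ ^ (M - n j.succ) / (c j.succ * n j.succ))) =
        (w ^ 2 / v ^ 2 * (ρ ^ (M - n j.succ) / c j.succ)) * ((M : ℝ) / n j.succ) := by
      field_simp
    rw [e, e']
    refine mul_le_mul_of_nonneg_left ?_ (by positivity)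
    rw [div_le_div_iff₀ hnj (by positivity)]
    linarith

/-! ### The induction on the dimension -/

/-- The bound in dimension `N` follows from the one in dimension `N - 1`: the derivative of
`K * ∑ c_j x ^ n_j - x ^ M` splits into its lowest term, a multiple of `M` times the corresponding
function in dimension `N - 1`, and a nonnegative combination of powers. -/
theorem threshold_preservesPositivity {N : ℕ} {n : Fin N → ℕ} {M : ℕ} (hn : StrictMono n)
    (hM : ∀ j, n j < M) {ρ : ℝ} (hρ : 0 < ρ) {c : Fin N → ℝ} (hc : ∀ j, 0 < c j) :
    EntrywisePreservesPositivity (fun x => threshold n M c ρ * (∑ j, c j * x ^ n j) - x ^ M)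
      (psdMatrices N (Set.Ioo 0 ρ)) := by
  induction N generalizing M with
  | zero =>
    intro A _
    rw [posSemidef_iff_sum]
    exact ⟨Matrix.IsSymm.ext fun i => i.elim0, fun x => by simp⟩
  | succ N ih =>
    set K := threshold n M c ρ with hK
    refine entrywisePreservesPositivity_succ
      (f' := fun x => K * (∑ j, c j * (n j * x ^ (n j - 1))) - M * x ^ (M - 1)) ?_ ?_ ?_
    · intro x _
      refine HasDerivAt.sub (HasDerivAt.const_mul _ (HasDerivAt.fun_sum fun j _ => ?_))
        (hasDerivAt_pow M x)
      exact (hasDerivAt_pow (n j) x).const_mul _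
    · intro u hu0 hur
      rw [posSemidef_iff_sum]
      refine ⟨Matrix.IsSymm.ext fun i k => by simp [mul_comm], fun x => ?_⟩
      have h := rankOne_inequality hρ hu0 hur hn hM hc x
      have hsq : ∀ m : ℕ, (∑ i, x i * u i ^ m) ^ 2 = ∑ i, ∑ k, x i * (u i * u k) ^ m * x k := by
        intro m
        rw [sq, Finset.sum_mul_sum]
        exact Finset.sum_congr rfl fun i _ => Finset.sum_congr rfl fun k _ => by ring
      rw [← hK, ← sub_nonneg] at h
      refine h.trans_eq ?_
      have hR : K * ∑ j, c j * (∑ i, x i * u i ^ n j) ^ 2 =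
          ∑ i, ∑ k, ∑ j, K * (c j * (x i * (u i * u k) ^ n j * x k)) := by
        simp only [hsq, Finset.mul_sum]
        rw [Finset.sum_comm]
        exact Finset.sum_congr rfl fun i _ => Finset.sum_comm
      rw [hR, hsq, ← Finset.sum_sub_distrib]
      refine Finset.sum_congr rfl fun i _ => ?_
      rw [← Finset.sum_sub_distrib]
      refine Finset.sum_congr rfl fun k _ => ?_
      simp only [Matrix.of_apply, Finset.mul_sum, mul_sub, sub_mul, Finset.sum_mul]
      exact congrArg (· - _) (Finset.sum_congr rfl fun j _ => by ring)
    · intro A hA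
      have hn1 : ∀ j : Fin N, n 0 < n j.succ := fun j => hn (Fin.succ_pos j)
      set n' : Fin N → ℕ := fun j => n j.succ - 1 with hn'
      set c' : Fin N → ℝ := fun j => c j.succ * n j.succ with hc'def
      have hn's : StrictMono n' := fun i j h => by
        have h1 : n i.succ < n j.succ := hn (by simpa using h)
        have h2 := hn1 i
        simp only [hn']
        omega
      have hM' : ∀ j, n' j < M - 1 := fun j => by
        have h1 := hM j.succ
        have h2 := hn1 j
        simp only [hn']
        omega
      have hc' : ∀ j, 0 < c' j := fun j => by
        have h2 : 0 < n j.succ := (Nat.zero_le _).trans_lt (hn1 j)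
        have h3 : (0 : ℝ) < n j.succ := by exact_mod_cast h2
        exact mul_pos (hc _) h3
      have hIH := ih hn's hM' hc' A hA
      have hle : M * threshold n' (M - 1) c' ρ ≤ K := mul_threshold_derivative_le hn hM hc hρ
      set K' := threshold n' (M - 1) c' ρ
      have hK0 : 0 ≤ K := threshold_nonneg n M hc hρ
      have p1 : ((K * (c 0 * n 0)) • hadamardPow A (n 0 - 1)).PosSemidef :=
        (hadamardPow_posSemidef hA.1 _).smul
          (mul_nonneg hK0 (mul_nonneg (hc 0).le (Nat.cast_nonneg _)))
      have p2 : ((K - M * K') • ∑ j, c' j • hadamardPow A (n' j)).PosSemidef :=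
        (Matrix.posSemidef_sum _ fun j _ => (hadamardPow_posSemidef hA.1 _).smul (hc' j).le).smul
          (sub_nonneg.2 hle)
      refine (congrArg Matrix.PosSemidef (Matrix.ext fun i k => ?_)).mp
        ((p1.add p2).add (hIH.smul (Nat.cast_nonneg M : (0 : ℝ) ≤ M)))
      simp only [Matrix.add_apply, Matrix.smul_apply, Matrix.sum_apply, hadamardPow,
        Matrix.map_apply, smul_eq_mul, Fin.sum_univ_succ (n := N), hn', hc'def, mul_assoc]
      ring

theorem hadamardPow_le_iff {N : ℕ} (A : Matrix (Fin N) (Fin N) ℝ) (n : Fin N → ℕ) (M : ℕ)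
    (c : Fin N → ℝ) (t : ℝ) :
    hadamardPow A M ≤ t • ∑ j, c j • hadamardPow A (n j) ↔
      (A.map fun x => t * (∑ j, c j * x ^ n j) - x ^ M).PosSemidef := by
  rw [Matrix.le_iff]
  refine iff_of_eq (congrArg Matrix.PosSemidef (Matrix.ext fun i k => ?_))
  simp [hadamardPow, Matrix.sum_apply]

theorem preservesPositivity_iff_hadamardPow_le {N : ℕ} (n : Fin N → ℕ) (M : ℕ) (c : Fin N → ℝ)
    (S : Set (Matrix (Fin N) (Fin N) ℝ)) {t : ℝ} (ht : 0 < t) :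
    EntrywisePreservesPositivity (fun x => (∑ j, c j * x ^ n j) + (-t⁻¹) * x ^ M) S ↔
      ∀ A ∈ S, hadamardPow A M ≤ t • ∑ j, c j • hadamardPow A (n j) := by
  refine forall₂_congr fun A _ => ?_
  rw [hadamardPow_le_iff]
  constructor
  · intro h
    refine (congrArg Matrix.PosSemidef (Matrix.ext fun i k => ?_)).mp (h.smul ht.le)
    simp only [Matrix.smul_apply, Matrix.map_apply, smul_eq_mul]
    field_simp
    ring
  · intro h
    refine (congrArg Matrix.PosSemidef (Matrix.ext fun i k => ?_)).mp (h.smul (inv_pos.2 ht).le)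
    simp only [Matrix.smul_apply, Matrix.map_apply, smul_eq_mul]
    field_simp
    ring

theorem mainTheorem6 (N : ℕ) (hN : 0 < N) (n : Fin N → ℕ) (M : ℕ) (hn : StrictMono n)
    (hM : ∀ j, n j < M) (ρ : ℝ) (hρ : 0 < ρ) (c : Fin N → ℝ) (hc : ∀ j, 0 < c j) :
    -- some negative coefficient of `x ^ M` is allowed
    (∃ cM : ℝ, cM < 0 ∧
      EntrywisePreservesPositivity (fun x => (∑ j, c j * x ^ n j) + cM * x ^ M)
        (psdMatrices N (Set.Ioo 0 ρ))) ∧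
    -- the matrix-inequality reformulation, in the Loewner order
    (∀ t : ℝ, 0 < t →
      (EntrywisePreservesPositivity (fun x => (∑ j, c j * x ^ n j) + (-t⁻¹) * x ^ M)
          (psdMatrices N (Set.Ioo 0 ρ)) ↔
        ∀ A ∈ psdMatrices N (Set.Ioo 0 ρ),
          hadamardPow A M ≤ t • ∑ j, c j • hadamardPow A (n j))) ∧
    -- the explicit threshold works
    0 < threshold n M c ρ ∧
    ∀ A ∈ psdMatrices N (Set.Ioo 0 ρ),
      hadamardPow A M ≤ threshold n M c ρ • ∑ j, c j • hadamardPow A (n j) := by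
  have hpos := threshold_pos hN hn hM hc hρ
  have hbound : ∀ A ∈ psdMatrices N (Set.Ioo 0 ρ),
      hadamardPow A M ≤ threshold n M c ρ • ∑ j, c j • hadamardPow A (n j) := fun A hA =>
    (hadamardPow_le_iff A n M c _).2 (threshold_preservesPositivity hn hM hρ hc A hA)
  refine ⟨⟨-(threshold n M c ρ)⁻¹, neg_lt_zero.2 (inv_pos.2 hpos), ?_⟩,
    fun t ht => preservesPositivity_iff_hadamardPow_le n M c _ ht, hpos, hbound⟩
  exact (preservesPositivity_iff_hadamardPow_le n M c _ hpos).2 hbound
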